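/- Let $\mathfrak g$ be a finite-dimensional real Lie algebra that is solvable and unimodular, i.e. $\operatorname{tr}(\operatorname{ad}_x)=0$ for all $x\in\mathfrak g$. Suppose that $\mathfrak g$ admits a Vaisman structure, that is, a pair $(J,\langle\cdot,\cdot\rangle)$ consisting of - a linear map $J:\mathfrak g\to\mathfrak g$ with $J^2=-\operatorname{Id}$ and $[Jx,Jy]-[x,y]-J([Jx,y]+[x,Jy])=0$ for all $x,y\in\mathfrak g$, and - an inner product $\langle\cdot,\cdot\rangle$ on $\mathfrak g$ with $\langle Jx,Jy\rangle=\langle x,y\rangle$ for all $x,y\in\mathfrak g$, such that there is $\theta\in\mathfrak g^*$ (the Lee form) with $d\theta=0$, $d\omega=\theta\wedge\omega$ and $\nabla\theta=0$. Here $\omega(x,y)=\langle Jx,y\rangle$, $d$ is the Chevalley–Eilenberg differential with trivial coefficients, and $\nabla$ is the Levi-Civita connection of $\langle\cdot,\cdot\rangle$, given by $\langle\nabla_xy,z\rangle=\tfrac12\left(\langle[x,y],z\rangle-\langle[y,z],x\rangle+\langle[z,x],y\rangle\right)$ and $(\nabla_x\theta)(y)=-\theta(\nabla_xy)$. Then for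 every $x\in\mathfrak g$ all complex eigenvalues of $\operatorname{ad}_x$ (the eigenvalues of its complexification) are purely imaginary, i.e. have real part $0$; in other words, $\mathfrak g$ is of type I. Moreover, if $\mathfrak g\neq 0$, then $0$ is an eigenvalue of $\operatorname{ad}_x$ for every $x\in\mathfrak g$. -/

import Mathlib

namespace VaismanLie

variable {g : Type*} [LieRing g] [LieAlgebra ℝ g]

/-- `g` is unimodular: every adjoint operator has trace zero. -/
def IsUnimodular (g : Type*) [LieRing g] [LieAlgebra ℝ g] : Prop :=
  ∀ x : g, LinearMap.trace ℝ g (LieAlgebra.ad ℝ g x) = 0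

/-- An integrable complex structure: `J² = -Id` and the Nijenhuis tensor of `J` vanishes. -/
structure IsComplexStructure (J : g →ₗ[ℝ] g) : Prop where
  sq : ∀ x, J (J x) = -x
  integrable : ∀ x y, ⁅J x, J y⁆ - ⁅x, y⁆ - J (⁅J x, y⁆ + ⁅x, J y⁆) = 0

/-- A (positive definite, symmetric, real) inner product on the vector space `g`. -/
structure InnerProd (g : Type*) [LieRing g] [LieAlgebra ℝ g] where
  form : LinearMap.BilinForm ℝ g
  symm : ∀ x y, form x y = form y x
  pos : ∀ x, x ≠ 0 → 0 < form x x

theorem InnerProd.nondegenerate (m : InnerProd g) : m.form.Nondegenerate := by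
  refine ⟨fun x hx => ?_, fun x hx => ?_⟩ <;>
  · by_contra h
    exact (m.pos x h).ne' (hx x)

/-- The inner product is Hermitian with respect to `J`. -/
def IsHermitian (J : g →ₗ[ℝ] g) (m : InnerProd g) : Prop :=
  ∀ x y, m.form (J x) (J y) = m.form x y

/-- The fundamental 2-form `ω(x, y) = ⟨J x, y⟩`. -/
def fundamentalForm (J : g →ₗ[ℝ] g) (m : InnerProd g) : LinearMap.BilinForm ℝ g :=
  m.form.comp J LinearMap.id

/-- The Chevalley-Eilenberg differential (trivial coefficients) of a 1-form. -/
def dOne (θ : Module.Dual ℝ g) (x y : g) : ℝ := -θ ⁅x, y⁆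

/-- The Chevalley-Eilenberg differential (trivial coefficients) of a 2-form. -/
def dTwo (ω : LinearMap.BilinForm ℝ g) (x y z : g) : ℝ :=
  -ω ⁅x, y⁆ z - ω ⁅y, z⁆ x - ω ⁅z, x⁆ y

/-- The wedge product of a 1-form and a 2-form. -/
def wedge (θ : Module.Dual ℝ g) (ω : LinearMap.BilinForm ℝ g) (x y z : g) : ℝ :=
  θ x * ω y z + θ y * ω z x + θ z * ω x y

/-- `θ` is a Lee form of `(J, m)`: it is closed and `dω = θ ∧ ω`. -/
structure IsLeeForm (J : g →ₗ[ℝ] g) (m : InnerProd g) (θ : Module.Dual ℝ g) : Prop where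
  closed : ∀ x y, dOne θ x y = 0
  d_fundamentalForm : ∀ x y z,
    dTwo (fundamentalForm J m) x y z = wedge θ (fundamentalForm J m) x y z

/-- For fixed `x`, `y`, the linear form `z ↦ ⟨∇_x y, z⟩` given by the Koszul formula for left
invariant vector fields and a left invariant metric. -/
noncomputable def koszul (m : InnerProd g) (x y : g) : Module.Dual ℝ g where
  toFun z := (1 / 2) * (m.form ⁅x, y⁆ z - m.form ⁅y, z⁆ x + m.form ⁅z, x⁆ y)
  map_add' a b := by simp; ring
  map_smul' c a := by simp; ring

/-- The Levi-Civita connection of the inner product: `∇_x y` is the vector that represents the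
Koszul form. -/
noncomputable def leviCivita [FiniteDimensional ℝ g] (m : InnerProd g) (x y : g) : g :=
  (m.form.toDual m.nondegenerate).symm (koszul m x y)

/-- The covariant derivative `(∇_x θ)(y) = -θ(∇_x y)` of a (left invariant) 1-form. -/
noncomputable def covDeriv [FiniteDimensional ℝ g] (m : InnerProd g) (θ : Module.Dual ℝ g)
    (x y : g) : ℝ :=
  -θ (leviCivita m x y)

/-- `(J, m)` is a Vaisman structure on `g`: a locally conformally Kähler structure whose Lee form
is parallel for the Levi-Civita connection. -/
structure IsVaisman [FiniteDimensional ℝ g] (J : g →ₗ[ℝ] g) (m : InnerProd g) : Prop where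
  complex : IsComplexStructure J
  hermitian : IsHermitian J m
  lee : ∃ θ : Module.Dual ℝ g, IsLeeForm J m θ ∧ ∀ x y, covDeriv m θ x y = 0

/-- `μ` is a complex eigenvalue of the real operator `ad_x`, i.e. an eigenvalue of its
complexification. -/
def IsAdEigenvalue (x : g) (μ : ℂ) : Prop :=
  Module.End.HasEigenvalue ((LieAlgebra.ad ℝ g x).baseChange ℂ) μ

/-- `g` is of type I: all complex eigenvalues of all operators `ad_x` are purely imaginary. -/
def IsTypeI (g : Type*) [LieRing g] [LieAlgebra ℝ g] : Prop :=
  ∀ (x : g) (μ : ℂ), IsAdEigenvalue x μ → μ.re = 0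

end VaismanLie

/-! Let `A` be the metric dual of the Lee form. The Vaisman identities make `ad A` and `ad (J A)`
skew and commuting with `J`. Contracting `dω = θ ∧ ω` with unimodularity gives `∑ [e i, J (e i)] =
(dim - 2) • J A` (`sum_bracket_J`), so outside dimension 2 the vector `J A` lies in the derived
algebra. There `ad` is nilpotent by Lie's theorem, and a skew nilpotent operator is zero: `J A` is
central (`bracket_J_A`).

Dividing by `J A` leaves a Kähler bracket with `∑ [e i, J (e i)] = 0`. For it, a trace identity and
a sum-of-squares argument in the style of Hano show that every `ad x` is skew on an ideal `n`
containing all brackets (`inner_bracket_self_eq_zero_of_kahler`). Eigenvectors for an eigenvalue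
with nonzero real part would project into `n`, where skewness kills them; being then multiples of
the central `J A`, they would have eigenvalue 0. The last claim holds because `[x, x] = 0`. -/

/-! ### Lie's theorem and the Killing form on the derived algebra. -/

/-- Lie's theorem supplies a common eigenvector `v`; commutators kill it, and induction on dimension
handles the quotient by its line. -/
theorem LieModule.isNilpotent_toEnd_of_mem_derivedSeries_one (k : Type*) {L : Type*} [Field k]
    [IsAlgClosed k] [CharZero k] [LieRing L] [LieAlgebra k L] [LieAlgebra.IsSolvable L]
    {y : L} (hy : y ∈ LieAlgebra.derivedSeries k L 1) (V : Type*) [AddCommGroup V] [Module k V]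
    [LieRingModule L V] [LieModule k L V] [Module.Finite k V] :
    _root_.IsNilpotent (LieModule.toEnd k L V y) := by
  induction h : Module.finrank k V using Nat.strong_induction_on generalizing V with
  | _ n ih =>
  subst h
  rcases subsingleton_or_nontrivial V with hV | hV
  · exact ⟨0, LinearMap.ext fun v => Subsingleton.elim _ _⟩
  obtain ⟨χ, hχ⟩ := LieModule.exists_nontrivial_weightSpace_of_isSolvable k L V
  obtain ⟨⟨v, hv⟩, hv0⟩ := exists_ne (0 : LieModule.weightSpace V χ)
  rw [LieModule.mem_weightSpace] at hv
  have hv0 : v ≠ 0 := by simpa using hv0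
  have hyv : ⁅y, v⁆ = 0 := by
    replace hy : y ∈ ((LieAlgebra.derivedSeries k L 1 : LieSubalgebra k L) : Submodule k L) := hy
    rw [LieAlgebra.coe_derivedSeries_one_eq] at hy
    clear ih
    induction hy using Submodule.span_induction with
    | mem z hz =>
      obtain ⟨a, b, rfl⟩ := hz
      rw [lie_lie, hv, hv, lie_smul, lie_smul, hv, hv, smul_smul, smul_smul, mul_comm, sub_self]
    | zero => simp
    | add a b _ _ ha hb => rw [add_lie, ha, hb, add_zero]
    | smul c a _ ha => rw [smul_lie, ha, smul_zero]
  let W : LieSubmodule k L V :=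
    { (k ∙ v) with
      lie_mem := by
        intro x m hm
        obtain ⟨c, rfl⟩ := Submodule.mem_span_singleton.mp hm
        rw [lie_smul, hv]
        exact Submodule.smul_mem _ _ (Submodule.smul_mem _ _ (Submodule.mem_span_singleton_self v)) }
  have hlt : Module.finrank k (V ⧸ W) < Module.finrank k V := by
    have h1 := Submodule.finrank_quotient_add_finrank W.toSubmodule
    have h2 : Module.finrank k W.toSubmodule = 1 := finrank_span_singleton hv0
    have h3 : Module.finrank k (V ⧸ W) = Module.finrank k (V ⧸ W.toSubmodule) := rfl
    omega
  obtain ⟨n, hn⟩ := ih _ hlt (V ⧸ W) rfl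
  refine ⟨n + 1, LinearMap.ext fun u => ?_⟩
  have key : ∀ m : ℕ, (LieSubmodule.Quotient.mk ((LieModule.toEnd k L V y ^ m) u) : V ⧸ W) =
      (LieModule.toEnd k L (V ⧸ W) y ^ m) (LieSubmodule.Quotient.mk u) := by
    intro m
    induction m with
    | zero => rfl
    | succ m ihm =>
      rw [pow_succ', pow_succ', Module.End.mul_apply, Module.End.mul_apply, ← ihm]; rfl
  have hmem : (LieModule.toEnd k L V y ^ n) u ∈ W := by
    rw [← LieSubmodule.Quotient.mk_eq_zero]
    exact (key n).trans (by rw [hn]; rfl)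
  obtain ⟨c, hc⟩ := Submodule.mem_span_singleton.mp hmem
  rw [pow_succ', Module.End.mul_apply, ← hc, LieModule.toEnd_apply_apply, lie_smul, hyv]
  simp

namespace VaismanLie

/-- The only trace of solvability used later. Lie's theorem needs an algebraically closed field,
hence the passage to `ℂ`. -/
theorem trace_ad_mul_ad_self_of_mem_derivedSeries_one {g : Type*} [LieRing g] [LieAlgebra ℝ g]
    [FiniteDimensional ℝ g] [LieAlgebra.IsSolvable g] {y : g}
    (hy : y ∈ LieAlgebra.derivedSeries ℝ g 1) :
    LinearMap.trace ℝ g (LieAlgebra.ad ℝ g y * LieAlgebra.ad ℝ g y) = 0 := by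
  have h1 : (1 : ℂ) ⊗ₜ[ℝ] y ∈ LieAlgebra.derivedSeries ℂ (TensorProduct ℝ ℂ g) 1 := by
    rw [LieAlgebra.derivedSeries_baseChange]
    exact LieSubmodule.tmul_mem_baseChange_of_mem _ hy
  have h2 := LieModule.isNilpotent_toEnd_of_mem_derivedSeries_one ℂ h1 (TensorProduct ℝ ℂ g)
  rw [LieModule.toEnd_baseChange] at h2
  have h3 : IsNilpotent ((LieAlgebra.ad ℝ g y * LieAlgebra.ad ℝ g y).baseChange ℂ) := by
    rw [LinearMap.baseChange_mul]
    exact (Commute.refl _).isNilpotent_mul_right h2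
  have h4 := (LinearMap.isNilpotent_trace_of_isNilpotent h3).eq_zero
  rw [LinearMap.trace_baseChange] at h4
  simpa using h4

/-! ### Complex eigenvalues in real terms. -/

open TensorProduct in
theorem exists_real_pair_of_isAdEigenvalue {g : Type*} [LieRing g] [LieAlgebra ℝ g] {x : g} {μ : ℂ}
    (h : IsAdEigenvalue x μ) : ∃ u w : g, (u ≠ 0 ∨ w ≠ 0) ∧
      ⁅x, u⁆ = μ.re • u - μ.im • w ∧ ⁅x, w⁆ = μ.im • u + μ.re • w := by
  obtain ⟨v, hv⟩ := h.exists_hasEigenvector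
  -- `R` and `I` take real and imaginary parts in the complexification.
  let R : ℂ ⊗[ℝ] g →ₗ[ℝ] g := (TensorProduct.lid ℝ g).toLinearMap ∘ₗ Complex.reLm.rTensor g
  let I : ℂ ⊗[ℝ] g →ₗ[ℝ] g := (TensorProduct.lid ℝ g).toLinearMap ∘ₗ Complex.imLm.rTensor g
  have hR : ∀ z y, R (z ⊗ₜ y) = z.re • y := fun z y => by simp [R]
  have hI : ∀ z y, I (z ⊗ₜ y) = z.im • y := fun z y => by simp [I]
  have hRf : ∀ v, R ((LieAlgebra.ad ℝ g x).baseChange ℂ v) = ⁅x, R v⁆ := fun v => by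
    induction v with
    | zero => simp
    | tmul z y => simp [hR]
    | add a b ha hb => rw [map_add, map_add, map_add, ha, hb, lie_add]
  have hIf : ∀ v, I ((LieAlgebra.ad ℝ g x).baseChange ℂ v) = ⁅x, I v⁆ := fun v => by
    induction v with
    | zero => simp
    | tmul z y => simp [hI]
    | add a b ha hb => rw [map_add, map_add, map_add, ha, hb, lie_add]
  have hRs : ∀ v, R (μ • v) = μ.re • R v - μ.im • I v := fun v => by
    induction v with
    | zero => simp
    | tmul z y => simp [hR, hI, TensorProduct.smul_tmul', smul_smul, sub_smul]
    | add a b ha hb => rw [smul_add, map_add, map_add, map_add, ha, hb]; module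
  have hIs : ∀ v, I (μ • v) = μ.im • R v + μ.re • I v := fun v => by
    induction v with
    | zero => simp
    | tmul z y =>
      simp only [hR, hI, TensorProduct.smul_tmul', smul_smul, smul_eq_mul, Complex.mul_im, add_smul]
      abel
    | add a b ha hb => rw [smul_add, map_add, map_add, map_add, ha, hb]; module
  have hdec : ∀ v, (1 : ℂ) ⊗ₜ[ℝ] R v + Complex.I ⊗ₜ[ℝ] I v = v := fun v => by
    induction v with
    | zero => simp
    | tmul z y =>
      rw [hR, hI, ← TensorProduct.smul_tmul, ← TensorProduct.smul_tmul, ← TensorProduct.add_tmul]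
      congr 1
      simp
    | add a b ha hb =>
      nth_rewrite 3 [← ha]
      nth_rewrite 3 [← hb]
      simp only [map_add, TensorProduct.tmul_add]
      abel
  refine ⟨R v, I v, ?_, ?_, ?_⟩
  · by_contra! hc
    apply hv.2
    rw [← hdec v, hc.1, hc.2]
    simp
  · rw [← hRf, hv.apply_eq_smul, hRs]
  · rw [← hIf, hv.apply_eq_smul, hIs]

open TensorProduct in
theorem isAdEigenvalue_zero {g : Type*} [LieRing g] [LieAlgebra ℝ g] [Nontrivial g] (x : g) :
    IsAdEigenvalue x 0 := by
  obtain ⟨z, hz, hxz⟩ : ∃ z : g, z ≠ 0 ∧ ⁅x, z⁆ = 0 := by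
    rcases eq_or_ne x 0 with rfl | hx
    · obtain ⟨z, hz⟩ := exists_ne (0 : g)
      exact ⟨z, hz, zero_lie z⟩
    · exact ⟨x, hx, lie_self x⟩
  refine Module.End.hasEigenvalue_of_hasEigenvector (x := (1 : ℂ) ⊗ₜ[ℝ] z) ⟨?_, ?_⟩
  · rw [Module.End.mem_eigenspace_iff]
    simp [hxz]
  · intro h
    have h' := congrArg (TensorProduct.lid ℝ g) (congrArg (Complex.reLm.rTensor g) h)
    exact hz (by simpa using h')

/-! ### Sums over structure constants. -/

section Sums

variable {ι : Type*} [Fintype ι]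

/-- Multiply the cyclic identity by `c i j k` and sum; by antisymmetry both cross sums equal minus
the left-hand side. -/
theorem sum_mul_swap_eq_half_sum_sq (c : ι → ι → ι → ℝ) (hanti : ∀ i j k, c i j k = -c j i k)
    (hcyc : ∀ i j k, c i j k + c j k i + c k i j = 0) :
    ∑ i, ∑ j, ∑ k, c i j k * c i k j = (1 / 2) * ∑ i, ∑ j, ∑ k, c i j k ^ 2 := by
  have h1 : ∑ i, ∑ j, ∑ k, c i j k * c j k i = -∑ i, ∑ j, ∑ k, c i j k * c i k j := by
    rw [Finset.sum_comm]
    simp only [← Finset.sum_neg_distrib]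
    refine Finset.sum_congr rfl fun i _ => Finset.sum_congr rfl fun j _ =>
      Finset.sum_congr rfl fun k _ => ?_
    rw [hanti j i k]; ring
  have h2 : ∑ i, ∑ j, ∑ k, c i j k * c k i j = -∑ i, ∑ j, ∑ k, c i j k * c i k j := by
    simp only [← Finset.sum_neg_distrib]
    refine Finset.sum_congr rfl fun i _ => Finset.sum_congr rfl fun j _ =>
      Finset.sum_congr rfl fun k _ => ?_
    rw [hanti k i j]; ring
  have h3 : ∑ i, ∑ j, ∑ k, c i j k ^ 2 + ∑ i, ∑ j, ∑ k, c i j k * c j k i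
      + ∑ i, ∑ j, ∑ k, c i j k * c k i j = 0 := by
    simp only [← Finset.sum_add_distrib]
    refine Finset.sum_eq_zero fun i _ => Finset.sum_eq_zero fun j _ =>
      Finset.sum_eq_zero fun k _ => ?_
    linear_combination c i j k * hcyc i j k
  linarith

/-- `p` is the indicator of the indices that span an ideal containing all brackets. -/
theorem structureConstants_of_sum_eq_zero (c : ι → ι → ι → ℝ) (p : ι → ℝ)
    (hp : ∀ i, p i = 0 ∨ p i = 1) (hanti : ∀ i j k, c i j k = -c j i k)
    (hpc : ∀ i j k, p k * c i j k = c i j k)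
    (htr : ∀ i, p i * ∑ j, ∑ k, c i j k * c i k j = 0)
    (hsum : ∑ i, ∑ j, ∑ k, c i j k ^ 2 + 2 * ∑ i, ∑ j, ∑ k, c i j k * c i k j = 0)
    (i j k : ι) (hj : p j = 1) (hk : p k = 1) : c i j k + c i k j = 0 := by
  -- The hypothesis `hsum` is rewritten as a vanishing sum of these squares. For `p j = p k = 1`,
  -- the first term gives `c i j k = 0` when `p i = 1` (the ideal is abelian), the last gives
  -- skewness when `p i = 0`.
  let F : ι → ι → ι → ℝ := fun i j k => p i * p j * c i j k ^ 2 +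
    (1 - p i) * (1 - p j) * c i j k ^ 2 + (1 - p i) * p j * p k * (c i j k + c i k j) ^ 2
  have hp0 : ∀ i, 0 ≤ p i := fun i => by rcases hp i with h | h <;> norm_num [h]
  have hp1 : ∀ i, 0 ≤ 1 - p i := fun i => by rcases hp i with h | h <;> norm_num [h]
  have hF0 : ∀ i j k, 0 ≤ F i j k := fun i j k => by
    have := hp0 i; have := hp0 j; have := hp0 k; have := hp1 i; have := hp1 j
    positivity
  have hs1 : ∑ i, ∑ j, ∑ k, (1 - p i) * p k * c i k j ^ 2 =
      ∑ i, ∑ j, ∑ k, (1 - p i) * p j * c i j k ^ 2 :=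
    Finset.sum_congr rfl fun i _ => Finset.sum_comm
  have hs2 : ∑ i, ∑ j, ∑ k, (1 - p i) * p j * c i j k ^ 2 =
      ∑ i, ∑ j, ∑ k, p i * (1 - p j) * c i j k ^ 2 := by
    rw [Finset.sum_comm]
    refine Finset.sum_congr rfl fun i _ => Finset.sum_congr rfl fun j _ =>
      Finset.sum_congr rfl fun k _ => ?_
    rw [hanti j i k]; ring
  have hs3 : ∑ i, ∑ j, ∑ k, p i * (c i j k * c i k j) = 0 := by
    refine Finset.sum_eq_zero fun i _ => ?_
    rw [← htr i]
    simp only [Finset.mul_sum]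
  have hFsum : ∑ i, ∑ j, ∑ k, F i j k = 0 := by
    have hexp : ∑ i, ∑ j, ∑ k, F i j k = ∑ i, ∑ j, ∑ k, c i j k ^ 2
        + 2 * ∑ i, ∑ j, ∑ k, c i j k * c i k j
        + ∑ i, ∑ j, ∑ k, (1 - p i) * p k * c i k j ^ 2
        - ∑ i, ∑ j, ∑ k, p i * (1 - p j) * c i j k ^ 2
        - 2 * ∑ i, ∑ j, ∑ k, p i * (c i j k * c i k j) := by
      simp only [Finset.mul_sum, ← Finset.sum_add_distrib, ← Finset.sum_sub_distrib]
      refine Finset.sum_congr rfl fun i _ => Finset.sum_congr rfl fun j _ =>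
        Finset.sum_congr rfl fun k _ => ?_
      have e1 := hpc i j k
      have e2 := hpc i k j
      rcases hp j with hj | hj <;> rcases hp k with hk | hk <;>
        simp only [F, hj, hk] at e1 e2 ⊢
      · rw [← e1, ← e2]; ring
      · rw [← e2]; ring
      · rw [← e1]; ring
      · ring
    rw [hexp, hs1, hs2, hs3, hsum]; ring
  have hF : F i j k = 0 := by
    have h1 := (Finset.sum_eq_zero_iff_of_nonneg fun i _ => Finset.sum_nonneg fun j _ =>
      Finset.sum_nonneg fun k _ => hF0 i j k).mp hFsum i (Finset.mem_univ i)
    have h2 := (Finset.sum_eq_zero_iff_of_nonneg fun j _ =>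
      Finset.sum_nonneg fun k _ => hF0 i j k).mp h1 j (Finset.mem_univ j)
    exact (Finset.sum_eq_zero_iff_of_nonneg fun k _ => hF0 i j k).mp h2 k (Finset.mem_univ k)
  have hF' : F i k j = 0 := by
    have h1 := (Finset.sum_eq_zero_iff_of_nonneg fun i _ => Finset.sum_nonneg fun j _ =>
      Finset.sum_nonneg fun k _ => hF0 i j k).mp hFsum i (Finset.mem_univ i)
    have h2 := (Finset.sum_eq_zero_iff_of_nonneg fun j _ =>
      Finset.sum_nonneg fun k _ => hF0 i j k).mp h1 k (Finset.mem_univ k)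
    exact (Finset.sum_eq_zero_iff_of_nonneg fun k _ => hF0 i _ k).mp h2 j (Finset.mem_univ j)
  rcases hp i with hi | hi
  · simp only [F, hi, hj, hk] at hF
    have : (c i j k + c i k j) ^ 2 = 0 := by linarith
    exact pow_eq_zero_iff two_ne_zero |>.mp this
  · simp only [F, hi, hj, hk] at hF hF'
    have h1 : c i j k ^ 2 = 0 := by linarith
    have h2 : c i k j ^ 2 = 0 := by linarith
    rw [pow_eq_zero_iff two_ne_zero] at h1 h2
    rw [h1, h2, add_zero]

end Sums

/-! ### Unimodular Kähler brackets on a Euclidean space. -/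

open scoped InnerProductSpace

variable {E : Type*} [NormedAddCommGroup E] [InnerProductSpace ℝ E] {ι : Type*} [Fintype ι]

theorem trace_mul_self_eq_sum (e : OrthonormalBasis ι ℝ E) (T : Module.End ℝ E) :
    LinearMap.trace ℝ E (T * T) = ∑ j, ∑ k, ⟪T (e j), e k⟫_ℝ * ⟪T (e k), e j⟫_ℝ := by
  classical
  rw [LinearMap.trace_eq_sum_inner _ e]
  refine Finset.sum_congr rfl fun j _ => ?_
  have h : T (e j) = ∑ k, ⟪T (e j), e k⟫_ℝ • e k := by
    conv_lhs => rw [← e.sum_repr' (T (e j))]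
    simp only [real_inner_comm]
  rw [Module.End.mul_apply, h, map_sum, inner_sum]
  refine Finset.sum_congr rfl fun k _ => ?_
  rw [← h, map_smul, inner_smul_right, real_inner_comm (T (e k))]

theorem norm_sq_eq_sum_inner (e : OrthonormalBasis ι ℝ E) (v : E) :
    ‖v‖ ^ 2 = ∑ k, ⟪v, e k⟫_ℝ ^ 2 := by
  rw [← e.sum_sq_norm_inner_left v]
  simp

theorem inner_bracket_eq_sum (e : OrthonormalBasis ι ℝ E) (b : E →ₗ[ℝ] E →ₗ[ℝ] E) (x y z : E) :
    ⟪b x y, z⟫_ℝ = ∑ i, ∑ j, ∑ k,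
      ⟪e i, x⟫_ℝ * ⟪e j, y⟫_ℝ * ⟪e k, z⟫_ℝ * ⟪b (e i) (e j), e k⟫_ℝ := by
  have h1 : ∀ (f : E →ₗ[ℝ] ℝ) (v : E), f v = ∑ i, ⟪e i, v⟫_ℝ * f (e i) := fun f v => by
    conv_lhs => rw [← e.sum_repr' v]
    simp
  have hx := h1 ((innerₗ E z).comp (b.flip y)) x
  simp only [LinearMap.comp_apply, LinearMap.flip_apply, innerₗ_apply_apply] at hx
  rw [real_inner_comm z, hx]
  refine Finset.sum_congr rfl fun i _ => ?_
  have hy := h1 ((innerₗ E z).comp (b (e i))) y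
  simp only [LinearMap.comp_apply, innerₗ_apply_apply] at hy
  rw [hy, Finset.mul_sum]
  refine Finset.sum_congr rfl fun j _ => ?_
  have hz := h1 (innerₗ E (b (e i) (e j))) z
  simp only [innerₗ_apply_apply] at hz
  rw [real_inner_comm _ z, hz, Finset.mul_sum, Finset.mul_sum]
  refine Finset.sum_congr rfl fun k _ => ?_
  ring

/-- For an integrable `J` and a bracket satisfying the Jacobi identity. -/
theorem trace_complexStructure_mul_bracket {E : Type*} [AddCommGroup E] [Module ℝ E]
    [FiniteDimensional ℝ E] {b : E →ₗ[ℝ] E →ₗ[ℝ] E} {J : Module.End ℝ E}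
    (hN : ∀ x y, b (J x) (J y) - b x y = J (b (J x) y + b x (J y)))
    (hjac : ∀ x y z, b (b x y) z = b x (b y z) - b y (b x z)) (x : E) :
    LinearMap.trace ℝ E (J * b (b x (J x))) =
      LinearMap.trace ℝ E (b x * b x) + LinearMap.trace ℝ E ((J * b x) * (J * b x)) := by
  have h1 : b (b x (J x)) = b x * b (J x) - b (J x) * b x := LinearMap.ext fun z => hjac _ _ z
  have h2 : b (J x) * J - J * b (J x) = b x + J * b x * J := by
    -- This is integrability with `x` fixed, read as an operator identity in `y`.
    ext y
    have := hN x y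
    rw [map_add] at this
    simp only [LinearMap.sub_apply, LinearMap.add_apply, Module.End.mul_apply]
    rw [sub_eq_iff_eq_add] at this
    rw [this]
    abel
  have h3 : LinearMap.trace ℝ E (J * (b x * b (J x))) =
      LinearMap.trace ℝ E (b (J x) * J * b x) := by
    rw [← mul_assoc, LinearMap.trace_mul_comm, mul_assoc]
  rw [h1, mul_sub, map_sub, h3, ← map_sub, ← mul_assoc, ← sub_mul, h2, add_mul, map_add]
  simp only [mul_assoc]

/-- An eigenbasis of the orthogonal projection onto `n` does this: eigenvalue 0 means orthogonal to
`n`, any other means inside `n`. -/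
theorem exists_adapted_orthonormalBasis [FiniteDimensional ℝ E] (n : Submodule ℝ E) :
    ∃ e : OrthonormalBasis (Fin (Module.finrank ℝ E)) ℝ E, ∀ i, e i ∈ n ∨ e i ∈ nᗮ := by
  have hT : (n.starProjection : E →ₗ[ℝ] E).IsSymmetric := n.starProjection_isSymmetric
  refine ⟨hT.eigenvectorBasis rfl, fun i => ?_⟩
  have h := hT.apply_eigenvectorBasis rfl i
  by_cases h0 : hT.eigenvalues rfl i = 0
  · right
    rw [h0] at h
    rw [← Submodule.starProjection_apply_eq_zero_iff]
    exact h.trans (by simp)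
  · left
    rw [← n.smul_mem_iff h0]
    have hmem := n.starProjection_apply_mem (hT.eigenvectorBasis rfl i)
    exact h ▸ hmem

/-- A unimodular Kähler bracket `b` acts skew-symmetrically on every subspace `n` that contains
all brackets and on which the Killing form of `b` is isotropic. Unimodularity enters as the
vanishing of `∑ i, b (e i) (J (e i))`. -/
theorem inner_bracket_self_eq_zero_of_kahler [FiniteDimensional ℝ E] {b : E →ₗ[ℝ] E →ₗ[ℝ] E}
    {J : Module.End ℝ E} (hanti : ∀ x y, b x y = -b y x)
    (hjac : ∀ x y z, b (b x y) z = b x (b y z) - b y (b x z))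
    (hJ : ∀ x y, ⟪J x, J y⟫_ℝ = ⟪x, y⟫_ℝ)
    (hN : ∀ x y, b (J x) (J y) - b x y = J (b (J x) y + b x (J y)))
    (hω : ∀ x y z, ⟪J (b x y), z⟫_ℝ + ⟪J (b y z), x⟫_ℝ + ⟪J (b z x), y⟫_ℝ = 0)
    (hH : ∀ e : OrthonormalBasis (Fin (Module.finrank ℝ E)) ℝ E, ∑ i, b (e i) (J (e i)) = 0)
    {n : Submodule ℝ E} (hn : ∀ x y, b x y ∈ n)
    (htr : ∀ y ∈ n, LinearMap.trace ℝ E (b y * b y) = 0) (x : E) {y : E} (hy : y ∈ n) :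
    ⟪b x y, y⟫_ℝ = 0 := by
  classical
  obtain ⟨e, he⟩ := exists_adapted_orthonormalBasis n
  let c := fun i j k => ⟪b (e i) (e j), e k⟫_ℝ
  let p : Fin (Module.finrank ℝ E) → ℝ := fun i => if e i ∈ n then 1 else 0
  have hp1 : ∀ i, p i = 1 ↔ e i ∈ n := fun i => by simp [p]
  have hcanti : ∀ i j k, c i j k = -c j i k := fun i j k => by
    simp only [c]; rw [hanti, inner_neg_left]
  -- Closedness of `ω` is the cyclic identity for the constants of `J ∘ b`, and `J` preserves norms.
  have hnorm : ∑ i, LinearMap.trace ℝ E ((J * b (e i)) * (J * b (e i))) =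
      (1 / 2) * ∑ i, ∑ j, ∑ k, c i j k ^ 2 := by
    have h1 := sum_mul_swap_eq_half_sum_sq (fun i j k => ⟪J (b (e i) (e j)), e k⟫_ℝ)
      (fun i j k => by rw [hanti, map_neg, inner_neg_left]) (fun i j k => hω _ _ _)
    have h2 : ∀ i j, ∑ k, ⟪J (b (e i) (e j)), e k⟫_ℝ ^ 2 = ∑ k, c i j k ^ 2 := fun i j => by
      rw [← norm_sq_eq_sum_inner, ← norm_sq_eq_sum_inner, ← real_inner_self_eq_norm_sq,
        ← real_inner_self_eq_norm_sq, hJ]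
    simp only [h2] at h1
    rw [← h1]
    exact Finset.sum_congr rfl fun i _ => trace_mul_self_eq_sum e _
  -- The trace identity summed over the basis; its left side is linear in `∑ b (e i) (J (e i)) = 0`.
  have hzero : ∑ i, LinearMap.trace ℝ E (b (e i) * b (e i)) +
      ∑ i, LinearMap.trace ℝ E ((J * b (e i)) * (J * b (e i))) = 0 := by
    rw [← Finset.sum_add_distrib]
    simp only [← trace_complexStructure_mul_bracket hN hjac]
    rw [← map_sum, ← Finset.mul_sum, ← map_sum, hH e]
    simp
  have hc := structureConstants_of_sum_eq_zero c p (fun i => by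
      by_cases h : e i ∈ n <;> simp [p, h]) hcanti (fun i j k => by
      rcases he k with h | h
      · rw [(hp1 k).mpr h, one_mul]
      · have : c i j k = 0 := Submodule.inner_right_of_mem_orthogonal (hn _ _) h
        rw [this, mul_zero]) (fun i => by
      by_cases h : e i ∈ n
      · rw [← trace_mul_self_eq_sum e (b (e i)), htr _ h, mul_zero]
      · simp [p, h]) (by
      rw [hnorm] at hzero
      simp only [trace_mul_self_eq_sum e (b _)] at hzero
      linarith)
  have hy0 : ∀ j, p j ≠ 1 → ⟪e j, y⟫_ℝ = 0 := fun j hj =>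
    Submodule.inner_left_of_mem_orthogonal hy ((he j).resolve_left fun h => hj ((hp1 j).mpr h))
  have hs : ⟪b x y, y⟫_ℝ = ∑ i, ∑ j, ∑ k,
      ⟪e i, x⟫_ℝ * ⟪e j, y⟫_ℝ * ⟪e k, y⟫_ℝ * c i k j := by
    rw [inner_bracket_eq_sum e]
    refine Finset.sum_congr rfl fun i _ => ?_
    rw [Finset.sum_comm]
    refine Finset.sum_congr rfl fun j _ => Finset.sum_congr rfl fun k _ => ?_
    simp only [c]; ring
  have h2 : ⟪b x y, y⟫_ℝ + ⟪b x y, y⟫_ℝ = 0 := by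
    nth_rewrite 1 [hs]
    rw [inner_bracket_eq_sum e]
    simp only [← Finset.sum_add_distrib]
    refine Finset.sum_eq_zero fun i _ => Finset.sum_eq_zero fun j _ =>
      Finset.sum_eq_zero fun k _ => ?_
    by_cases hj : p j = 1
    · by_cases hk : p k = 1
      · linear_combination (⟪e i, x⟫_ℝ * ⟪e j, y⟫_ℝ * ⟪e k, y⟫_ℝ) * hc i j k hj hk
      · rw [hy0 k hk]; ring
    · rw [hy0 j hj]; ring
  linarith

/-- For skew `T`, the trace of `T * T` is `-∑ ‖T (e i)‖ ^ 2`. -/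
theorem eq_zero_of_skew_of_trace_mul_self [FiniteDimensional ℝ E] {T : Module.End ℝ E}
    (hT : ∀ x y, ⟪T x, y⟫_ℝ = -⟪x, T y⟫_ℝ) (htr : LinearMap.trace ℝ E (T * T) = 0) : T = 0 := by
  let e := stdOrthonormalBasis ℝ E
  have h1 : ∑ i, ‖T (e i)‖ ^ 2 = 0 := by
    rw [← neg_eq_zero, ← htr, LinearMap.trace_eq_sum_inner _ e, ← Finset.sum_neg_distrib]
    refine Finset.sum_congr rfl fun i _ => ?_
    rw [Module.End.mul_apply, ← real_inner_self_eq_norm_sq, hT, neg_neg]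
  rw [Finset.sum_eq_zero_iff_of_nonneg fun i _ => sq_nonneg _] at h1
  refine e.toBasis.ext fun i => ?_
  have := h1 i (Finset.mem_univ i)
  simpa using this

/-! ### Vaisman identities and centrality of `J A`. -/

/-- The bracket `b`, complex structure `J` and Lee vector `A` (the metric dual of the Lee form)
of a unimodular Vaisman Lie algebra with underlying Euclidean space `E`. -/
structure IsVaismanBracket (b : E →ₗ[ℝ] E →ₗ[ℝ] E) (J : Module.End ℝ E) (A : E) : Prop where
  anti : ∀ x y, b x y = -b y x
  jacobi : ∀ x y z, b (b x y) z = b x (b y z) - b y (b x z)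
  unimodular : ∀ x, LinearMap.trace ℝ E (b x) = 0
  sq : ∀ x, J (J x) = -x
  isometry : ∀ x y, ⟪J x, J y⟫_ℝ = ⟪x, y⟫_ℝ
  integrable : ∀ x y, b (J x) (J y) - b x y = J (b (J x) y + b x (J y))
  closed : ∀ x y, ⟪A, b x y⟫_ℝ = 0
  lee : ∀ x y z, -⟪J (b x y), z⟫_ℝ - ⟪J (b y z), x⟫_ℝ - ⟪J (b z x), y⟫_ℝ =
    ⟪A, x⟫_ℝ * ⟪J y, z⟫_ℝ + ⟪A, y⟫_ℝ * ⟪J z, x⟫_ℝ + ⟪A, z⟫_ℝ * ⟪J x, y⟫_ℝ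
  parallel : ∀ x y, ⟪b A x, y⟫_ℝ = -⟪x, b A y⟫_ℝ

namespace IsVaismanBracket

variable {b : E →ₗ[ℝ] E →ₗ[ℝ] E} {J : Module.End ℝ E} {A : E}

theorem inner_J_left (h : IsVaismanBracket b J A) (x y : E) : ⟪J x, y⟫_ℝ = -⟪x, J y⟫_ℝ := by
  rw [← h.isometry x, h.sq, inner_neg_right, neg_neg]

theorem bracket_self (h : IsVaismanBracket b J A) (x : E) : b x x = 0 := by
  refine (smul_eq_zero.mp (?_ : (2 : ℝ) • b x x = 0)).resolve_left two_ne_zero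
  rw [two_smul]
  nth_rewrite 1 [h.anti x x]
  exact neg_add_cancel _

theorem inner_A_J_A (h : IsVaismanBracket b J A) : ⟪A, J A⟫_ℝ = 0 := by
  have := h.inner_J_left A A
  rw [real_inner_comm] at this
  linarith

/-- Compare the Lee identity at `(A, y, z)` and `(A, J y, J z)`. The terms in `b y z` and `b (J y)
(J z)` agree because `A` is orthogonal to all brackets. -/
theorem bracket_A_J (h : IsVaismanBracket b J A) (y : E) : b A (J y) = J (b A y) := by
  rw [← sub_eq_zero]
  refine ext_inner_right ℝ fun z => ?_
  have e1 := h.lee A y z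
  have e2 := h.lee A (J y) (J z)
  have e3 : ⟪J (b (J y) (J z)), A⟫_ℝ = ⟪J (b y z), A⟫_ℝ := by
    have := congrArg (fun v => ⟪J v, A⟫_ℝ) (h.integrable y z)
    simp only [map_sub, inner_sub_left, h.sq, inner_neg_left] at this
    rw [real_inner_comm A (_ + _), inner_add_right, h.closed, h.closed] at this
    linarith
  rw [e3] at e2
  rw [h.anti (J z) A, h.anti z A] at *
  simp only [map_neg, inner_neg_left, h.isometry, h.sq, inner_neg_left] at e1 e2
  have e4 : ⟪b A (J z), y⟫_ℝ = ⟪J (b A y), z⟫_ℝ := by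
    rw [h.parallel, real_inner_comm, ← h.inner_J_left]
  have e5 : ⟪J (b A z), y⟫_ℝ = ⟪b A (J y), z⟫_ℝ := by
    rw [h.inner_J_left, h.parallel, neg_neg, real_inner_comm]
  have e6 : ⟪J z, A⟫_ℝ = ⟪A, J z⟫_ℝ := real_inner_comm _ _
  have e7 : ⟪J A, y⟫_ℝ = -⟪A, J y⟫_ℝ := h.inner_J_left _ _
  have e8 : ⟪z, A⟫_ℝ = ⟪A, z⟫_ℝ := real_inner_comm _ _
  rw [inner_sub_left, inner_zero_left]
  rw [e5, e6, e7, h.inner_J_left y] at e1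
  rw [e4, e8] at e2
  linarith

theorem bracket_A_J_A (h : IsVaismanBracket b J A) : b A (J A) = 0 := by
  rw [h.bracket_A_J, h.bracket_self, map_zero]

theorem bracket_J_A_J (h : IsVaismanBracket b J A) (y : E) : b (J A) (J y) = J (b (J A) y) := by
  have := h.integrable A y
  rw [h.bracket_A_J, map_add, h.sq] at this
  rw [sub_eq_iff_eq_add] at this
  rw [this]
  abel

/-- At `(J A, x, y)` the form `θ ∧ ω` vanishes, so `J ∘ b (J A)` is symmetric; since `b (J A)`
commutes with `J`, it is skew. -/
theorem bracket_J_A_skew (h : IsVaismanBracket b J A) (x y : E) :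
    ⟪b (J A) x, y⟫_ℝ = -⟪x, b (J A) y⟫_ℝ := by
  have e1 : ∀ x y, ⟪J (b (J A) x), y⟫_ℝ = ⟪J (b (J A) y), x⟫_ℝ := fun x y => by
    have e2 := h.lee (J A) x y
    rw [h.anti y (J A), map_neg, inner_neg_left, h.isometry, h.isometry, h.sq, inner_neg_left,
      h.inner_A_J_A, real_inner_comm A, h.closed, real_inner_comm A y] at e2
    linarith
  rw [← h.isometry, e1, h.bracket_J_A_J, h.sq, inner_neg_left, real_inner_comm]

/-- The Lee identity at `(A, x, y)`: the two `b A` terms cancel because `J ∘ b A` is symmetric. -/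
theorem inner_J_A_bracket (h : IsVaismanBracket b J A) (x y : E) :
    ⟪J A, b x y⟫_ℝ =
      ‖A‖ ^ 2 * ⟪J x, y⟫_ℝ + ⟪A, x⟫_ℝ * ⟪J y, A⟫_ℝ + ⟪A, y⟫_ℝ * ⟪J A, x⟫_ℝ := by
  have e1 := h.lee A x y
  rw [h.anti y A, map_neg, inner_neg_left, real_inner_self_eq_norm_sq] at e1
  have e2 : ⟪J (b A y), x⟫_ℝ = ⟪J (b A x), y⟫_ℝ := by
    rw [h.inner_J_left, h.parallel, neg_neg, h.bracket_A_J, real_inner_comm]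
  have e3 : ⟪J (b x y), A⟫_ℝ = -⟪J A, b x y⟫_ℝ := by
    rw [h.inner_J_left, real_inner_comm]
  rw [e2, e3] at e1
  linarith

theorem sum_bracket_J [FiniteDimensional ℝ E] (h : IsVaismanBracket b J A) {ι : Type*} [Fintype ι]
    (e : OrthonormalBasis ι ℝ E) :
    ∑ i, b (e i) (J (e i)) = ((Fintype.card ι : ℝ) - 2) • J A := by
  -- Sum the Lee identity over `(e i, J (e i), w)`. Two bracket sums are multiples of the trace of
  -- `b w`, hence zero; `θ ∧ ω` contributes `dim - 1 - 1` times `⟪A, w⟫`.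
  have key : J (∑ i, b (e i) (J (e i))) = -(((Fintype.card ι : ℝ) - 2) • A) := by
    refine ext_inner_right ℝ fun w => ?_
    have e1 : ∑ i, ⟪J (b (J (e i)) w), e i⟫_ℝ = 0 := by
      have h1 : LinearMap.trace ℝ E (J * (b w * J)) = 0 := by
        have h2 : J * J = -1 := LinearMap.ext fun x => by simp [h.sq]
        rw [LinearMap.trace_mul_comm, mul_assoc, h2, mul_neg, mul_one, map_neg, h.unimodular,
          neg_zero]
      rw [LinearMap.trace_eq_sum_inner _ e] at h1
      rw [← neg_eq_zero, ← h1, ← Finset.sum_neg_distrib]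
      refine Finset.sum_congr rfl fun i _ => ?_
      rw [h.anti, map_neg, inner_neg_left, neg_neg, real_inner_comm]
      rfl
    have e2 : ∑ i, ⟪J (b w (e i)), J (e i)⟫_ℝ = 0 := by
      rw [← h.unimodular w, LinearMap.trace_eq_sum_inner _ e]
      refine Finset.sum_congr rfl fun i _ => ?_
      rw [h.isometry, real_inner_comm]
    have e3 : ∑ i, ⟪A, e i⟫_ℝ * ⟪J (J (e i)), w⟫_ℝ = -⟪A, w⟫_ℝ := by
      rw [← e.sum_inner_mul_inner A w, ← Finset.sum_neg_distrib]
      refine Finset.sum_congr rfl fun i _ => ?_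
      rw [h.sq, inner_neg_left, mul_neg]
    have e4 : ∑ i, ⟪A, J (e i)⟫_ℝ * ⟪J w, e i⟫_ℝ = -⟪A, w⟫_ℝ := by
      rw [← h.isometry A w, ← e.sum_inner_mul_inner (J A) (J w), ← Finset.sum_neg_distrib]
      refine Finset.sum_congr rfl fun i _ => ?_
      rw [h.inner_J_left A, real_inner_comm (e i) (J w)]
      ring
    have e5 : ∑ i, ⟪A, w⟫_ℝ * ⟪J (e i), J (e i)⟫_ℝ = Fintype.card ι * ⟪A, w⟫_ℝ := by
      simp only [h.isometry, real_inner_self_eq_norm_sq, e.norm_eq_one]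
      simp
    have e6 := Finset.sum_congr (rfl : (Finset.univ : Finset ι) = _)
      fun i _ => h.lee (e i) (J (e i)) w
    simp only [Finset.sum_sub_distrib, Finset.sum_add_distrib, Finset.sum_neg_distrib] at e6
    rw [e1, e2, e3, e4, e5] at e6
    rw [map_sum, sum_inner, inner_neg_left, real_inner_smul_left]
    linarith
  have := congrArg J key
  rw [h.sq, map_neg, map_smul] at this
  exact neg_injective this

theorem bracket_J_A [FiniteDimensional ℝ E] (h : IsVaismanBracket b J A) {D : Submodule ℝ E}
    (hD : ∀ x y, b x y ∈ D) (htr : ∀ y ∈ D, LinearMap.trace ℝ E (b y * b y) = 0) :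
    b (J A) = 0 := by
  -- In dimension 2 the sum formula says nothing about `J A`; but then `A`, if nonzero, and `J A`
  -- form a commuting basis.
  by_cases hd : (Module.finrank ℝ E : ℝ) - 2 = 0
  · by_cases hA : A = 0
    · rw [hA, map_zero, map_zero]
    have hA0 : ⟪A, A⟫_ℝ ≠ 0 := fun h0 => hA (inner_self_eq_zero.mp h0)
    have hli : LinearIndependent ℝ ![A, J A] := by
      rw [LinearIndependent.pair_iff]
      intro s t hst
      have h1 := congrArg (fun v => ⟪A, v⟫_ℝ) hst
      have h2 := congrArg (fun v => ⟪J A, v⟫_ℝ) hst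
      simp only [inner_add_right, real_inner_smul_right, h.inner_A_J_A, h.isometry,
        real_inner_comm A (J A), inner_zero_right, mul_zero, add_zero, zero_add] at h1 h2
      exact ⟨(mul_eq_zero.mp h1).resolve_right hA0, (mul_eq_zero.mp h2).resolve_right hA0⟩
    have hspan := hli.span_eq_top_of_card_eq_finrank' (by
      have : (Module.finrank ℝ E : ℝ) = 2 := by linarith
      rw [Fintype.card_fin]
      exact_mod_cast this.symm)
    refine LinearMap.ext_on_range hspan fun i => ?_
    fin_cases i
    · change b (J A) A = 0
      rw [h.anti, h.bracket_A_J_A, neg_zero]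
    · exact h.bracket_self _
  · refine eq_zero_of_skew_of_trace_mul_self h.bracket_J_A_skew (htr _ ?_)
    have hs := h.sum_bracket_J (stdOrthonormalBasis ℝ E)
    rw [Fintype.card_fin] at hs
    rw [← D.smul_mem_iff hd, ← hs]
    exact D.sum_mem fun i _ => hD _ _

/-! ### The Kähler quotient by `J A`. -/

/-- The orthogonal projection along `J A`; it is the identity if `A = 0`. -/
noncomputable def projJA (J : Module.End ℝ E) (A : E) : Module.End ℝ E :=
  LinearMap.id - (innerₗ E (J A)).smulRight ((‖A‖ ^ 2)⁻¹ • J A)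

theorem projJA_apply (J : Module.End ℝ E) (A x : E) :
    projJA J A x = x - ⟪J A, x⟫_ℝ • (‖A‖ ^ 2)⁻¹ • J A := rfl

/-- The bracket of the central quotient by `J A`, extended trivially to `E`. -/
noncomputable def kahlerBracket (b : E →ₗ[ℝ] E →ₗ[ℝ] E) (J : Module.End ℝ E) (A : E) :
    E →ₗ[ℝ] E →ₗ[ℝ] E := b.compr₂ (projJA J A)

theorem kahlerBracket_apply (x y : E) : kahlerBracket b J A x y = projJA J A (b x y) := rfl

theorem projJA_J_A (h : IsVaismanBracket b J A) : projJA J A (J A) = 0 := by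
  rw [projJA_apply, h.isometry, real_inner_self_eq_norm_sq, smul_smul]
  by_cases hA : A = 0
  · simp [hA]
  · rw [mul_inv_cancel₀ (by simpa using hA), one_smul, sub_self]

theorem bracket_projJA_right (h : IsVaismanBracket b J A) (hB : b (J A) = 0) (x y : E) :
    b x (projJA J A y) = b x y := by
  rw [projJA_apply, map_sub, map_smul, map_smul, h.anti x (J A), hB]
  simp

theorem bracket_projJA_left (hB : b (J A) = 0) (x : E) :
    b (projJA J A x) = b x := by
  rw [projJA_apply, map_sub, map_smul, map_smul, hB]
  simp

theorem kahlerBracket_mem {D : Submodule ℝ E} (hD : ∀ x y, b x y ∈ D) (x y : E) :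
    kahlerBracket b J A x y ∈ D ⊔ Submodule.span ℝ {J A} := by
  rw [kahlerBracket_apply, projJA_apply]
  refine Submodule.sub_mem _ (Submodule.mem_sup_left (hD x y)) (Submodule.mem_sup_right ?_)
  exact Submodule.smul_mem _ _ (Submodule.smul_mem _ _ (Submodule.mem_span_singleton_self _))

/-- Both bracket combinations are already orthogonal to `J A`, so the projection fixes them. -/
theorem kahlerBracket_integrable (h : IsVaismanBracket b J A) (x y : E) :
    kahlerBracket b J A (J x) (J y) - kahlerBracket b J A x y =
      J (kahlerBracket b J A (J x) y + kahlerBracket b J A x (J y)) := by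
  have e1 : ⟪J A, b (J x) (J y)⟫_ℝ - ⟪J A, b x y⟫_ℝ = 0 := by
    rw [← inner_sub_right, h.integrable, h.isometry, inner_add_right, h.closed, h.closed, add_zero]
  have e2 : ⟪J A, b (J x) y⟫_ℝ + ⟪J A, b x (J y)⟫_ℝ = 0 := by
    rw [← inner_add_right, h.inner_J_left, ← h.integrable, inner_sub_right, h.closed, h.closed,
      sub_zero, neg_zero]
  simp only [kahlerBracket_apply]
  rw [← map_sub, ← map_add, projJA_apply, projJA_apply, inner_sub_right, inner_add_right, e1, e2,
    zero_smul, sub_zero, sub_zero, h.integrable]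

/-- Removing the `J A` component, known from `inner_J_A_bracket`, cancels exactly `θ ∧ ω`. -/
theorem kahlerBracket_closed (h : IsVaismanBracket b J A) (x y z : E) :
    ⟪J (kahlerBracket b J A x y), z⟫_ℝ + ⟪J (kahlerBracket b J A y z), x⟫_ℝ +
      ⟪J (kahlerBracket b J A z x), y⟫_ℝ = 0 := by
  have e1 := h.lee x y z
  by_cases hA : A = 0
  · simp only [kahlerBracket_apply, projJA_apply, hA, map_zero, smul_zero, sub_zero,
      inner_zero_left, zero_mul, add_zero] at e1 ⊢
    linarith
  have hA' : ‖A‖ ^ 2 ≠ 0 := by simpa using hA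
  have e2 : ∀ x y z, ⟪J (kahlerBracket b J A x y), z⟫_ℝ =
      ⟪J (b x y), z⟫_ℝ + ⟪J A, b x y⟫_ℝ * (‖A‖ ^ 2)⁻¹ * ⟪A, z⟫_ℝ := fun x y z => by
    rw [kahlerBracket_apply, projJA_apply, map_sub, map_smul, map_smul, h.sq, inner_sub_left,
      real_inner_smul_left, real_inner_smul_left, inner_neg_left]
    ring
  have e3 : ∀ x, ⟪J x, A⟫_ℝ = -⟪J A, x⟫_ℝ := fun x => by
    rw [h.inner_J_left, real_inner_comm]
  rw [e2, e2, e2, h.inner_J_A_bracket, h.inner_J_A_bracket, h.inner_J_A_bracket]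
  simp only [e3]
  field_simp
  linear_combination (-‖A‖ ^ 2) * e1

theorem inner_kahlerBracket_self [FiniteDimensional ℝ E] (h : IsVaismanBracket b J A)
    {D : Submodule ℝ E} (hD : ∀ x y, b x y ∈ D)
    (htr : ∀ y ∈ D, LinearMap.trace ℝ E (b y * b y) = 0) (x : E) {y : E}
    (hy : y ∈ D ⊔ Submodule.span ℝ {J A}) : ⟪kahlerBracket b J A x y, y⟫_ℝ = 0 := by
  have hB := h.bracket_J_A hD htr
  refine inner_bracket_self_eq_zero_of_kahler (J := J) (fun x y => ?_) (fun x y z => ?_) h.isometry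
    h.kahlerBracket_integrable h.kahlerBracket_closed (fun e => ?_) (kahlerBracket_mem hD)
    (fun y hy => ?_) x hy
  · rw [kahlerBracket_apply, kahlerBracket_apply, h.anti, map_neg]
  · simp only [kahlerBracket_apply]
    rw [bracket_projJA_left hB, h.bracket_projJA_right hB, h.bracket_projJA_right hB, h.jacobi,
      map_sub]
  · simp only [kahlerBracket_apply]
    rw [← map_sum, h.sum_bracket_J e, map_smul, h.projJA_J_A, smul_zero]
  · obtain ⟨d, hd, v, hv, rfl⟩ := Submodule.mem_sup.mp hy
    obtain ⟨c, rfl⟩ := Submodule.mem_span_singleton.mp hv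
    have h1 : b (d + c • J A) = b d := by rw [map_add, map_smul, hB, smul_zero, add_zero]
    have h2 : kahlerBracket b J A (d + c • J A) = projJA J A * b d := by
      rw [← h1]; rfl
    -- By centrality the projection is absorbed on the right of `b d`, so the trace of the square is
    -- unchanged.
    have h3 : b d * projJA J A = b d := LinearMap.ext fun z => h.bracket_projJA_right hB d z
    rw [h2, mul_assoc, LinearMap.trace_mul_comm, ← mul_assoc, h3, mul_assoc, h3]
    exact htr d hd

theorem re_eq_zero_of_bracket_eq [FiniteDimensional ℝ E] (h : IsVaismanBracket b J A)
    {D : Submodule ℝ E} (hD : ∀ x y, b x y ∈ D)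
    (htr : ∀ y ∈ D, LinearMap.trace ℝ E (b y * b y) = 0) {x u w : E} {α β : ℝ}
    (huw : u ≠ 0 ∨ w ≠ 0) (hu : b x u = α • u - β • w) (hw : b x w = β • u + α • w) : α = 0 := by
  by_contra hα
  have hB := h.bracket_J_A hD htr
  have hαβ : α ^ 2 + β ^ 2 ≠ 0 := by positivity
  let Q := projJA J A
  let n : Submodule ℝ E := D ⊔ Submodule.span ℝ {J A}
  have hskew := fun (y : E) (hy : y ∈ n) => h.inner_kahlerBracket_self hD htr x hy
  have hu' : kahlerBracket b J A x (Q u) = α • Q u - β • Q w := by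
    rw [kahlerBracket_apply, h.bracket_projJA_right hB, hu, map_sub, map_smul, map_smul]
  have hw' : kahlerBracket b J A x (Q w) = β • Q u + α • Q w := by
    rw [kahlerBracket_apply, h.bracket_projJA_right hB, hw, map_add, map_smul, map_smul]
  -- As `α ^ 2 + β ^ 2 ≠ 0`, the eigenvalue equations can be inverted, writing `Q u` and `Q w` as
  -- combinations of brackets.
  have hun : Q u ∈ n := by
    rw [← n.smul_mem_iff hαβ]
    have : (α ^ 2 + β ^ 2) • Q u =
        α • kahlerBracket b J A x (Q u) + β • kahlerBracket b J A x (Q w) := by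
      rw [hu', hw']; module
    rw [this]
    exact n.add_mem (n.smul_mem _ (kahlerBracket_mem hD _ _))
      (n.smul_mem _ (kahlerBracket_mem hD _ _))
  have hwn : Q w ∈ n := by
    rw [← n.smul_mem_iff hαβ]
    have : (α ^ 2 + β ^ 2) • Q w =
        α • kahlerBracket b J A x (Q w) - β • kahlerBracket b J A x (Q u) := by
      rw [hu', hw']; module
    rw [this]
    exact n.sub_mem (n.smul_mem _ (kahlerBracket_mem hD _ _))
      (n.smul_mem _ (kahlerBracket_mem hD _ _))
  have e1 := hskew _ hun
  have e2 := hskew _ hwn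
  rw [hu', inner_sub_left, real_inner_smul_left, real_inner_smul_left] at e1
  rw [hw', inner_add_left, real_inner_smul_left, real_inner_smul_left,
    real_inner_comm (Q w)] at e2
  have e3 : α * (⟪Q u, Q u⟫_ℝ + ⟪Q w, Q w⟫_ℝ) = 0 := by linarith
  have e4 := (mul_eq_zero.mp e3).resolve_left hα
  have p1 := real_inner_self_nonneg (x := Q u)
  have p2 := real_inner_self_nonneg (x := Q w)
  have z1 : Q u = 0 := inner_self_eq_zero.mp (by linarith : ⟪Q u, Q u⟫_ℝ = 0)
  have z2 : Q w = 0 := inner_self_eq_zero.mp (by linarith : ⟪Q w, Q w⟫_ℝ = 0)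
  -- `Q u = 0` puts `u` on the central line of `J A`; likewise `w`.
  have b1 : b x u = 0 := by
    rw [← h.bracket_projJA_right hB]; exact (congrArg (b x) z1).trans (map_zero _)
  have b2 : b x w = 0 := by
    rw [← h.bracket_projJA_right hB]; exact (congrArg (b x) z2).trans (map_zero _)
  have f1 : (α ^ 2 + β ^ 2) • u = 0 := by
    have : (α ^ 2 + β ^ 2) • u = α • b x u + β • b x w := by rw [hu, hw]; module
    rw [this, b1, b2]; simp
  have f2 : (α ^ 2 + β ^ 2) • w = 0 := by
    have : (α ^ 2 + β ^ 2) • w = α • b x w - β • b x u := by rw [hu, hw]; module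
    rw [this, b1, b2]; simp
  rcases huw with h0 | h0
  · exact h0 ((smul_eq_zero.mp f1).resolve_left hαβ)
  · exact h0 ((smul_eq_zero.mp f2).resolve_left hαβ)

end IsVaismanBracket

/-! ### From the Lie algebra to the Euclidean setting. -/

variable {g : Type*} [LieRing g] [LieAlgebra ℝ g]

/-- The inner product space structure on `g` given by an `InnerProd`. -/
noncomputable abbrev InnerProd.toCore (m : InnerProd g) : InnerProductSpace.Core ℝ g where
  inner x y := m.form x y
  conj_inner_symm x y := m.symm y x
  re_inner_nonneg x := by
    rcases eq_or_ne x 0 with rfl | hx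
    · simp
    · exact (m.pos x hx).le
  add_left x y z := by simp
  smul_left x y r := by simp
  definite x hx := by
    by_contra h
    exact (m.pos x h).ne' hx

theorem form_leviCivita [FiniteDimensional ℝ g] (m : InnerProd g) (x y z : g) :
    m.form (leviCivita m x y) z =
      (1 / 2) * (m.form ⁅x, y⁆ z - m.form ⁅y, z⁆ x + m.form ⁅z, x⁆ y) := by
  rw [leviCivita, LinearMap.BilinForm.apply_toDual_symm_apply]
  rfl

/-- In the Koszul formula closedness kills the `⟨[x, y], A⟩` term; what remains is the symmetric
part of `ad A`. -/
theorem form_bracket_skew_of_covDeriv_eq_zero [FiniteDimensional ℝ g] {m : InnerProd g}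
    {θ : Module.Dual ℝ g} {A : g} (hA : ∀ x, θ x = m.form A x) (hclosed : ∀ x y, dOne θ x y = 0)
    (hpar : ∀ x y, covDeriv m θ x y = 0) (x y : g) :
    m.form ⁅A, x⁆ y = -m.form x ⁅A, y⁆ := by
  have h1 := hpar x y
  have h2 := hclosed x y
  rw [covDeriv, hA, m.symm, form_leviCivita] at h1
  rw [dOne, hA, m.symm] at h2
  rw [← lie_skew, map_neg, LinearMap.neg_apply] at h1
  rw [m.symm x]
  have h3 : m.form ⁅y, A⁆ x = - m.form ⁅A, y⁆ x := by
    rw [← lie_skew, map_neg, LinearMap.neg_apply]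
  have h4 : m.form ⁅y, x⁆ A = - m.form ⁅x, y⁆ A := by
    rw [← lie_skew, map_neg, LinearMap.neg_apply]
  linarith

theorem isTypeI_of_isVaisman [FiniteDimensional ℝ g] [LieAlgebra.IsSolvable g]
    (hg : IsUnimodular g) {J : g →ₗ[ℝ] g} {m : InnerProd g} (hV : IsVaisman J m) : IsTypeI g := by
  obtain ⟨θ, hθ, hpar⟩ := hV.lee
  let A := (m.form.toDual m.nondegenerate).symm θ
  have hA : ∀ x, θ x = m.form A x := fun x => by
    rw [LinearMap.BilinForm.apply_toDual_symm_apply]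
  let : NormedAddCommGroup g := m.toCore.toNormedAddCommGroup
  let : InnerProductSpace ℝ g := InnerProductSpace.ofCore m.toCore.toCore
  have hb : IsVaismanBracket (E := g) (LieAlgebra.ad ℝ g : g →ₗ[ℝ] Module.End ℝ g) J A :=
    { anti := fun x y => (lie_skew x y).symm
      jacobi := fun x y z => lie_lie x y z
      unimodular := hg
      sq := hV.complex.sq
      isometry := hV.hermitian
      integrable := fun x y => sub_eq_zero.mp (hV.complex.integrable x y)
      closed := fun x y => by
        have h := hθ.closed x y
        rw [dOne, neg_eq_zero, hA] at h
        exact h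
      lee := fun x y z => by
        have h := hθ.d_fundamentalForm x y z
        simp only [wedge, hA] at h
        exact h
      parallel := form_bracket_skew_of_covDeriv_eq_zero hA hθ.closed hpar }
  intro x μ hμ
  obtain ⟨u, w, huw, hu, hw⟩ := exists_real_pair_of_isAdEigenvalue hμ
  exact hb.re_eq_zero_of_bracket_eq (D := (LieAlgebra.derivedSeries ℝ g 1).toSubmodule)
    (fun x y => LieSubmodule.lie_mem_lie (LieSubmodule.mem_top x) (LieSubmodule.mem_top y))
    (fun y hy => trace_ad_mul_ad_self_of_mem_derivedSeries_one hy) huw hu hw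

end VaismanLie

theorem mainTheorem3 {g : Type*} [LieRing g] [LieAlgebra ℝ g] [FiniteDimensional ℝ g]
    [LieAlgebra.IsSolvable g] (hg : VaismanLie.IsUnimodular g)
    (hV : ∃ (J : g →ₗ[ℝ] g) (m : VaismanLie.InnerProd g), VaismanLie.IsVaisman J m) :
    VaismanLie.IsTypeI g ∧ (Nontrivial g → ∀ x : g, VaismanLie.IsAdEigenvalue x 0) := by
  obtain ⟨J, m, h⟩ := hV
  exact ⟨VaismanLie.isTypeI_of_isVaisman hg h, fun _ x => VaismanLie.isAdEigenvalue_zero x⟩
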